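/- There is a universal constant $C$ such that the following holds for every integer $N\ge 2$, every set $\mathcal Y$ and every total search problem $R\subseteq\{0,1\}^N\times\mathcal Y$ (total: for every $X\in\{0,1\}^N$ there is a $Y\in\mathcal Y$ with $(X,Y)\in R$): $$\mathsf D(R)\;\le\; C\cdot \mathsf{psQ}(R)^5\cdot\log_2 N .$$ Here $\mathsf D(R)$ is the deterministic query complexity of $R$, the least depth of a decision tree that queries bits of $X$ and on every input $X\in\{0,1\}^N$ outputs some $Y$ with $(X,Y)\in R$. And $\mathsf{psQ}(R)$ is the pseudo-deterministic quantum query complexity of $R$, the least number of queries of a quantum query algorithm $\mathcal A$ (input-independent unitaries on an index register, an answer qubit and a finite-dimensional workspace, interleaved with uses of the oracle $U_X|i\rangle|j\rangle=|i\rangle|j\oplus X_i\rangle$, followed by a POVM with outcomes in $\mathcal Y$) for which there is a function $f:\{0,1\}^N\to\mathcal Y$ with $(X,f(X))\in R$ and $\Pr[\mathcal A(X)=f(X)]\ge 2/3$ for every $X\in\{0,1\}^N$. -/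

import Mathlib

open scoped ComplexOrder ENNReal NNReal

universe u

noncomputable section

namespace QueryComplexity

/-- A search problem on inputs `X ∈ {0,1}^N` with solutions in `Y`; `(X, y) ∈ R` says that `y` is a
solution on input `X`. -/
abbrev SearchProblem (N : ℕ) (Y : Type u) : Type u := Set ((Fin N → Bool) × Y)

/-- The problem is total: every string in `{0,1}^N` is a valid input, that is, has a solution. -/
def SearchProblem.IsTotal {N : ℕ} {Y : Type u} (R : SearchProblem N Y) : Prop :=
  ∀ X : Fin N → Bool, ∃ y : Y, (X, y) ∈ R

/-! ### Deterministic query algorithms -/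

/-- Deterministic query algorithms: binary decision trees with outputs in `Y` at the leaves. At an
inner node an index `i` is queried and the algorithm goes on according to the answer. -/
inductive DecisionTree (N : ℕ) (Y : Type u) : Type u
  | leaf (y : Y) : DecisionTree N Y
  | query (i : Fin N) (next : Bool → DecisionTree N Y) : DecisionTree N Y

/-- The output of a decision tree on input `X`. -/
def DecisionTree.output {N : ℕ} {Y : Type u} : DecisionTree N Y → (Fin N → Bool) → Y
  | .leaf y, _ => y
  | .query i next, X => (next (X i)).output X

/-- The worst-case number of queries of a decision tree. -/
def DecisionTree.depth {N : ℕ} {Y : Type u} : DecisionTree N Y → ℕ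
  | .leaf _ => 0
  | .query _ next => max (next false).depth (next true).depth + 1

/-- The decision tree outputs a solution on every input. -/
def DecisionTree.Solves {N : ℕ} {Y : Type u} (T : DecisionTree N Y) (R : SearchProblem N Y) :
    Prop :=
  ∀ X : Fin N → Bool, (X, T.output X) ∈ R

/-- The deterministic query complexity `D(R)`, the least depth of a decision tree that solves `R`
(`⊤` if there is none). -/
def D {N : ℕ} {Y : Type u} (R : SearchProblem N Y) : ℕ∞ :=
  ⨅ (T : DecisionTree N Y) (_ : T.Solves R), (T.depth : ℕ∞)

/-! ### Quantum query algorithms -/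

/-- The computational basis `|i⟩|j⟩|k⟩` of index register, answer qubit and `w`-dimensional
workspace. -/
abbrev Basis (N w : ℕ) : Type := Fin N × Bool × Fin w

/-- The oracle unitary of the input `X`: `|i⟩|j⟩|k⟩ ↦ |i⟩|j ⊕ X_i⟩|k⟩`. -/
def oracle {N w : ℕ} (X : Fin N → Bool) : Matrix (Basis N w) (Basis N w) ℂ :=
  fun b c => if b = (c.1, xor c.2.1 (X c.1), c.2.2) then 1 else 0

/-- A quantum query algorithm with outputs in `Y`: from a fixed basis state it applies
`U₀, O_X, U₁, O_X, …, O_X, U_q`, where `q` is the number of queries, and then performs a POVM whose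
outcomes are labelled by `Y`. The unitaries `U t` with `t > q` are not used. -/
structure QuantumAlgorithm (N : ℕ) (Y : Type u) : Type u where
  /-- the number `q` of queries -/
  queries : ℕ
  /-- the dimension of the workspace -/
  workspace : ℕ
  /-- the initial basis state -/
  init : Basis N workspace
  /-- the unitaries between the queries, which do not depend on the input -/
  U : ℕ → Matrix.unitaryGroup (Basis N workspace) ℂ
  /-- the POVM elements; only finitely many of them are nonzero -/
  povm : Y →₀ Matrix (Basis N workspace) (Basis N workspace) ℂ
  povm_posSemidef : ∀ y, (povm y).PosSemidef
  povm_sum : (povm.sum fun _ E => E) = 1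

namespace QuantumAlgorithm

variable {N : ℕ} {Y : Type u}

/-- The state on input `X` after `t` queries and the unitary that follows them. -/
def state (A : QuantumAlgorithm N Y) (X : Fin N → Bool) : ℕ → (Basis N A.workspace → ℂ)
  | 0 => (A.U 0 : Matrix _ _ ℂ).mulVec (Pi.single A.init 1)
  | t + 1 => (A.U (t + 1) : Matrix _ _ ℂ).mulVec ((oracle X).mulVec (A.state X t))

/-- The probability `⟨ψ|E_y|ψ⟩` that the output on input `X` is `y`. -/
def prob (A : QuantumAlgorithm N Y) (X : Fin N → Bool) (y : Y) : ℝ :=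
  (dotProduct (star (A.state X A.queries)) ((A.povm y).mulVec (A.state X A.queries))).re

/-- `A` is a pseudo-deterministic algorithm for `R`: there is a function `f` of canonical solutions
such that `A` outputs `f X` with probability at least `2/3` on every input `X`. -/
def PseudoDeterministicallySolves (A : QuantumAlgorithm N Y) (R : SearchProblem N Y) : Prop :=
  ∃ f : (Fin N → Bool) → Y, ∀ X : Fin N → Bool, (X, f X) ∈ R ∧ 2 / 3 ≤ A.prob X (f X)

end QuantumAlgorithm

/-- The pseudo-deterministic bounded-error quantum query complexity `psQ(R)`, the least number of
queries of a pseudo-deterministic quantum algorithm for `R` (`⊤` if there is none). -/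
def psQ {N : ℕ} {Y : Type u} (R : SearchProblem N Y) : ℕ∞ :=
  ⨅ (A : QuantumAlgorithm N Y) (_ : A.PseudoDeterministicallySolves R), (A.queries : ℕ∞)

end QueryComplexity

end

/-! A pseudo-deterministic algorithm with `q` queries computes its function `f` of canonical
solutions with bounded error. A decision tree for `f` also solves `R`, so it suffices to build one
of depth `O(q^4)`. This is stronger than the claim, because `q^4 ≤ q^5` and `log₂ N ≥ 1`.

One quantum lower bound does all the work, the adversary bound `sum_weight_le` with nonnegative
weights on pairs of inputs. Putting weight 1 on the pairs formed by an input and its sensitive flips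
gives block sensitivity `O(q^2)`. A second choice of weights gives degree `O(q^2)`: if the `±1`
indicator of an output has a nonzero alternating sum over a subcube with directions `M`, then its
product with the parity takes one value on more than half of the cube. By the spectral form of
Huang's theorem the edges in directions `M` inside that majority carry a weighting of norm at least
`√#M`, and `f` changes along each of these edges.

A largest monomial of the indicator on a subcube survives every fixing of the remaining free bits,
so its variables contain a sensitive block of every input of the subcube. Querying these `O(q^2)`
variables therefore lowers the block sensitivity of the remaining subcube by at least one, and
`O(q^2)` rounds suffice. -/

noncomputable section

namespace QueryComplexity

open Matrix Finset

/-! ### Inner products of query states -/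

section

/-- The real part of the standard inner product. -/
def reInner {n : Type*} [Fintype n] (u v : n → ℂ) : ℝ := (star u ⬝ᵥ v).re

section reInner

variable {n : Type*} [Fintype n]

lemma reInner_eq_sum (u v : n → ℂ) : reInner u v = ∑ b, (star (u b) * v b).re := by
  simp [reInner, dotProduct]

lemma reInner_self (u : n → ℂ) : reInner u u = ∑ b, ‖u b‖ ^ 2 := by
  rw [reInner_eq_sum]
  refine sum_congr rfl fun b _ => ?_
  rw [Complex.sq_norm, Complex.normSq_apply]
  simp

lemma reInner_comm (u v : n → ℂ) : reInner u v = reInner v u := by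
  simp only [reInner_eq_sum]
  refine sum_congr rfl fun b _ => ?_
  simp
  ring

lemma reInner_sub_self (u v : n → ℂ) :
    reInner (u - v) (u - v) = reInner u u + reInner v v - 2 * reInner u v := by
  have h : reInner (u - v) (u - v)
      = reInner u u - reInner u v - (reInner v u - reInner v v) := by
    simp [reInner, sub_dotProduct, dotProduct_sub]
    ring
  rw [h, reInner_comm v u]
  ring

lemma reInner_unitary_mulVec [DecidableEq n] (U : Matrix.unitaryGroup n ℂ) (u v : n → ℂ) :
    reInner ((U : Matrix n n ℂ) *ᵥ u) ((U : Matrix n n ℂ) *ᵥ v) = reInner u v := by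
  have hU : (U : Matrix n n ℂ)ᴴ * (U : Matrix n n ℂ) = 1 := by
    have := Matrix.UnitaryGroup.star_mul_self U
    rwa [Matrix.star_eq_conjTranspose] at this
  simp only [reInner]
  rw [star_mulVec, ← dotProduct_mulVec, mulVec_mulVec, hU, one_mulVec]

/-- The quadratic form of a matrix. -/
def quadForm (E : Matrix n n ℂ) (u : n → ℂ) : ℝ := reInner u (E *ᵥ u)

lemma quadForm_nonneg {E : Matrix n n ℂ} (hE : E.PosSemidef) (u : n → ℂ) : 0 ≤ quadForm E u := by
  have := hE.dotProduct_mulVec_nonneg u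
  exact (Complex.le_def.1 this).1

/-- A weighted triangle inequality, obtained from nonnegativity of the form at `2u - 3v`. The
coefficient `3/2` turns a probability of at most `1/3` into at most `1/2`, which stays below `2/3`.
-/
lemma quadForm_le_add {E : Matrix n n ℂ} (hE : E.PosSemidef) (u v : n → ℂ) :
    quadForm E u ≤ 3 / 2 * quadForm E v + 3 * quadForm E (u - v) := by
  have h := quadForm_nonneg hE ((2 : ℂ) • u - (3 : ℂ) • v)
  have e1 : quadForm E ((2 : ℂ) • u - (3 : ℂ) • v) = 4 * quadForm E u + 9 * quadForm E v
      - 6 * (reInner u (E *ᵥ v) + reInner v (E *ᵥ u)) := by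
    simp [quadForm, reInner, mulVec_sub, mulVec_smul, sub_dotProduct, dotProduct_sub]
    ring
  have e2 : quadForm E (u - v) = quadForm E u + quadForm E v
      - (reInner u (E *ᵥ v) + reInner v (E *ᵥ u)) := by
    simp [quadForm, reInner, mulVec_sub, sub_dotProduct, dotProduct_sub]
    ring
  linarith

lemma quadForm_sum {ι : Type*} (s : Finset ι) (E : ι → Matrix n n ℂ) (u : n → ℂ) :
    quadForm (∑ y ∈ s, E y) u = ∑ y ∈ s, quadForm (E y) u := by
  simp [quadForm, reInner, sum_mulVec, dotProduct_sum]

lemma quadForm_one [DecidableEq n] (u : n → ℂ) : quadForm 1 u = reInner u u := by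
  simp [quadForm]

end reInner

variable {N : ℕ} {w : ℕ}

lemma oracle_mulVec (X : Fin N → Bool) (u : Basis N w → ℂ) (b : Basis N w) :
    (oracle X *ᵥ u) b = u (b.1, xor b.2.1 (X b.1), b.2.2) := by
  simp only [mulVec, dotProduct, oracle, ite_mul, one_mul, zero_mul]
  rw [sum_eq_single (b.1, xor b.2.1 (X b.1), b.2.2)]
  · simp
  · rintro ⟨i, j, k⟩ - hc
    rw [if_neg]
    rintro rfl
    simp at hc
  · simp

/-- The squared norm of the part of the state that queries the index `i`. -/
def queryWeight (u : Basis N w → ℂ) (i : Fin N) : ℝ := ∑ c : Bool × Fin w, ‖u (i, c)‖ ^ 2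

lemma queryWeight_nonneg (u : Basis N w → ℂ) (i : Fin N) : 0 ≤ queryWeight u i :=
  sum_nonneg fun _ _ => by positivity

lemma sum_queryWeight (u : Basis N w → ℂ) : ∑ i, queryWeight u i = reInner u u := by
  rw [reInner_self, Fintype.sum_prod_type]
  rfl

lemma queryWeight_oracle (X : Fin N → Bool) (u : Basis N w → ℂ) (i : Fin N) :
    queryWeight (oracle X *ᵥ u) i = queryWeight u i := by
  simp only [queryWeight, oracle_mulVec]
  rw [Fintype.sum_prod_type, Fintype.sum_prod_type]
  cases X i <;> simp [add_comm]

/-- The contribution of the index `i` to the inner product. -/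
def reInnerAt (i : Fin N) (u v : Basis N w → ℂ) : ℝ :=
  ∑ c : Bool × Fin w, (star (u (i, c)) * v (i, c)).re

lemma sum_reInnerAt (u v : Basis N w → ℂ) : ∑ i, reInnerAt i u v = reInner u v := by
  rw [reInner_eq_sum, Fintype.sum_prod_type]
  rfl

lemma abs_sum_reInnerAt_le (s : Finset (Fin N)) (u v : Basis N w → ℂ) :
    |∑ i ∈ s, reInnerAt i u v| ≤ √(∑ i ∈ s, queryWeight u i) * √(∑ i ∈ s, queryWeight v i) := by
  simp only [reInnerAt, queryWeight, ← sum_product']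
  refine (abs_sum_le_sum_abs _ _).trans ?_
  refine le_trans (sum_le_sum fun p _ => ?_) (Real.sum_mul_le_sqrt_mul_sqrt _ _ _)
  refine (Complex.abs_re_le_norm _).trans ?_
  simp

lemma reInnerAt_oracle {X X' : Fin N → Bool} {i : Fin N} (h : X i = X' i)
    (u v : Basis N w → ℂ) :
    reInnerAt i (oracle X *ᵥ u) (oracle X' *ᵥ v) = reInnerAt i u v := by
  simp only [reInnerAt, oracle_mulVec]
  rw [Fintype.sum_prod_type, Fintype.sum_prod_type]
  rw [← h]
  cases X i <;> simp [add_comm]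

/-- The two oracles act alike on every index where the inputs agree, so only differing indices
contribute. Cauchy–Schwarz bounds their contribution before and after the query, whence the factor
2; the oracle preserves query weights. -/
lemma reInner_sub_reInner_oracle_le (X X' : Fin N → Bool) (u v : Basis N w → ℂ) :
    reInner u v - reInner (oracle X *ᵥ u) (oracle X' *ᵥ v) ≤
      2 * (√(∑ i with X i ≠ X' i, queryWeight u i) *
        √(∑ i with X i ≠ X' i, queryWeight v i)) := by
  have h0 : reInner u v - reInner (oracle X *ᵥ u) (oracle X' *ᵥ v)
      = ∑ i with X i ≠ X' i, reInnerAt i u v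
        - ∑ i with X i ≠ X' i, reInnerAt i (oracle X *ᵥ u) (oracle X' *ᵥ v) := by
    rw [← sum_reInnerAt, ← sum_reInnerAt, ← sum_sub_distrib, ← sum_sub_distrib]
    symm
    refine sum_subset (subset_univ _) fun i _ hi => ?_
    rw [reInnerAt_oracle (by simpa using hi), sub_self]
  have h1 := abs_le.1 (abs_sum_reInnerAt_le {i | X i ≠ X' i} u v)
  have h2 := abs_le.1 (abs_sum_reInnerAt_le {i | X i ≠ X' i} (oracle X *ᵥ u) (oracle X' *ᵥ v))
  simp only [queryWeight_oracle] at h2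
  rw [h0]
  linarith [h1.2, h2.1]

lemma reInner_oracle_self (X : Fin N → Bool) (u : Basis N w → ℂ) :
    reInner (oracle X *ᵥ u) (oracle X *ᵥ u) = reInner u u := by
  rw [← sum_reInnerAt, ← sum_reInnerAt]
  exact sum_congr rfl fun i _ => reInnerAt_oracle rfl u u

/-! ### The adversary bound -/

namespace QuantumAlgorithm

variable {Y : Type u} (A : QuantumAlgorithm N Y)

lemma reInner_state_self (X : Fin N → Bool) (t : ℕ) :
    reInner (A.state X t) (A.state X t) = 1 := by
  induction t with
  | zero =>
    rw [state, reInner_unitary_mulVec, reInner_self, sum_eq_single A.init]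
    · simp
    · intro b _ hb
      simp [Pi.single_eq_of_ne hb]
    · simp
  | succ t ih => rw [state, reInner_unitary_mulVec, reInner_oracle_self, ih]

lemma quadForm_povm_add_le {y y' : Y} (h : y ≠ y') (u : Basis N A.workspace → ℂ) :
    quadForm (A.povm y) u + quadForm (A.povm y') u ≤ reInner u u := by
  classical
  have h1 : ∑ z ∈ A.povm.support ∪ {y, y'}, A.povm z = 1 := by
    rw [← A.povm_sum, Finsupp.sum]
    symm
    refine sum_subset subset_union_left fun z _ hz => by simpa using hz
  rw [← quadForm_one, ← h1, quadForm_sum, ← sum_pair (f := fun z => quadForm (A.povm z) u) h]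
  exact sum_le_sum_of_subset_of_nonneg subset_union_right
    fun z _ _ => quadForm_nonneg (A.povm_posSemidef z) u

lemma quadForm_povm_le (y : Y) (u : Basis N A.workspace → ℂ) :
    quadForm (A.povm y) u ≤ reInner u u := by
  classical
  have h1 : ∑ z ∈ A.povm.support ∪ {y}, A.povm z = 1 := by
    rw [← A.povm_sum, Finsupp.sum]
    symm
    refine sum_subset subset_union_left fun z _ hz => by simpa using hz
  rw [← quadForm_one, ← h1, quadForm_sum,
    ← sum_singleton (fun z => quadForm (A.povm z) u) y]
  exact sum_le_sum_of_subset_of_nonneg subset_union_right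
    fun z _ _ => quadForm_nonneg (A.povm_posSemidef z) u

/-- The final states on inputs with different canonical outputs are far apart. -/
lemma reInner_final_le {f : (Fin N → Bool) → Y} (hf : ∀ X, 2 / 3 ≤ A.prob X (f X))
    {X X' : Fin N → Bool} (h : f X ≠ f X') :
    reInner (A.state X A.queries) (A.state X' A.queries) ≤ 35 / 36 := by
  set u := A.state X A.queries with hu
  set v := A.state X' A.queries with hv
  have h1 : 2 / 3 ≤ quadForm (A.povm (f X)) u := hf X
  have h2 : 2 / 3 ≤ quadForm (A.povm (f X')) v := hf X'
  have h3 := A.quadForm_povm_add_le h v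
  have h4 := quadForm_le_add (A.povm_posSemidef (f X)) u v
  have h5 := A.quadForm_povm_le (f X) (u - v)
  rw [reInner_sub_self] at h5
  have e1 : reInner u u = 1 := A.reInner_state_self X _
  have e2 : reInner v v = 1 := A.reInner_state_self X' _
  -- On `v` the outcome `f X` has probability at most `1/3`, so `2/3 ≤ 1/2 + 3 * (2 - 2r)` for the
  -- inner product `r`, that is, `r ≤ 35/36`.
  linarith

/-- The adversary bound with nonnegative weights. -/
theorem sum_weight_le {f : (Fin N → Bool) → Y} (hf : ∀ X, 2 / 3 ≤ A.prob X (f X))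
    {P : Type*} [Fintype P] (x x' : P → Fin N → Bool) (wt : P → ℝ) (hwt : ∀ p, 0 ≤ wt p)
    (hne : ∀ p, wt p ≠ 0 → f (x p) ≠ f (x' p)) {B : ℝ}
    (hB : ∀ μ : (Fin N → Bool) → Fin N → ℝ, (∀ X i, 0 ≤ μ X i) → (∀ X, ∑ i, μ X i = 1) →
      ∑ p, wt p * (√(∑ i with x p i ≠ x' p i, μ (x p) i) *
        √(∑ i with x p i ≠ x' p i, μ (x' p) i)) ≤ B) :
    ∑ p, wt p ≤ 72 * A.queries * B := by
  -- The potential is the weighted sum of inner products. It starts at the total weight, and each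
  -- query lowers it by at most `2 * B`, by `hB` for the distributions of the queried index.
  have step : ∀ t : ℕ, ∑ p, wt p - 2 * t * B ≤
      ∑ p, wt p * reInner (A.state (x p) t) (A.state (x' p) t) := by
    intro t
    induction t with
    | zero =>
      have : ∀ p, reInner (A.state (x p) 0) (A.state (x' p) 0) = 1 := fun p =>
        A.reInner_state_self (x p) 0
      simp [this]
    | succ t ih =>
      have hb := hB (fun X i => queryWeight (A.state X t) i)
        (fun X i => queryWeight_nonneg _ i)
        (fun X => by rw [sum_queryWeight, A.reInner_state_self])
      have h1 : ∑ p, wt p * reInner (A.state (x p) t) (A.state (x' p) t)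
          - ∑ p, wt p * reInner (A.state (x p) (t + 1)) (A.state (x' p) (t + 1)) ≤ 2 * B := by
        rw [← sum_sub_distrib]
        refine le_trans (sum_le_sum fun p _ => ?_)
          ((mul_sum _ _ _).symm.trans_le (mul_le_mul_of_nonneg_left hb (by norm_num)))
        rw [← mul_sub, state, state, reInner_unitary_mulVec, mul_left_comm]
        exact mul_le_mul_of_nonneg_left (reInner_sub_reInner_oracle_le _ _ _ _) (hwt p)
      push_cast
      linarith
  have hfin : ∑ p, wt p * reInner (A.state (x p) A.queries) (A.state (x' p) A.queries)
      ≤ 35 / 36 * ∑ p, wt p := by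
    rw [mul_sum]
    refine sum_le_sum fun p _ => ?_
    by_cases h : wt p = 0
    · simp [h]
    · rw [mul_comm]
      exact mul_le_mul_of_nonneg_right (A.reInner_final_le hf (hne p h)) (hwt p)
  -- The potential has to lose a fraction `1/36` of the total weight at rate `2 * B` per query, and
  -- `72 = 36 * 2`.
  linarith [step A.queries]

end QuantumAlgorithm

end

/-! ### Huang's theorem in spectral form -/

section

variable {N : ℕ}

/-- Flip the bit `i`. -/
def flipBit (i : Fin N) (b : Fin N → Bool) : Fin N → Bool := fun j => xor (b j) (decide (j = i))

@[simp] lemma flipBit_flipBit (i : Fin N) (b : Fin N → Bool) : flipBit i (flipBit i b) = b := by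
  ext j; simp [flipBit]

lemma flipBit_comm (i j : Fin N) (b : Fin N → Bool) :
    flipBit i (flipBit j b) = flipBit j (flipBit i b) := by
  ext k; exact Bool.xor_right_comm ..

@[simp] lemma flipBit_same (i : Fin N) (b : Fin N → Bool) : flipBit i b i = !(b i) := by
  simp [flipBit]

lemma flipBit_of_ne {i j : Fin N} (h : j ≠ i) (b : Fin N → Bool) : flipBit i b j = b j := by
  simp [flipBit, h]

/-- `flipBit i` as a permutation of the cube. -/
def flipBitEquiv (i : Fin N) : Equiv.Perm (Fin N → Bool) where
  toFun := flipBit i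
  invFun := flipBit i
  left_inv := flipBit_flipBit i
  right_inv := flipBit_flipBit i

lemma sum_flipBit (i : Fin N) (F : (Fin N → Bool) → ℝ) : ∑ b, F (flipBit i b) = ∑ b, F b :=
  Equiv.sum_comp (flipBitEquiv i) F

/-- The character `(-1) ^ ∑ i ∈ M, b i`. -/
def sgn (M : Finset (Fin N)) (b : Fin N → Bool) : ℝ := ∏ i ∈ M, if b i then -1 else 1

lemma sgn_flipBit_of_mem {M : Finset (Fin N)} {i : Fin N} (hi : i ∈ M) (b : Fin N → Bool) :
    sgn M (flipBit i b) = -sgn M b := by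
  rw [sgn, sgn, ← mul_prod_erase _ _ hi, ← mul_prod_erase _ _ hi, flipBit_same, ← neg_mul]
  congr 1
  · cases b i <;> simp
  · exact prod_congr rfl fun j hj => by rw [flipBit_of_ne (ne_of_mem_erase hj)]

lemma sgn_flipBit_of_notMem {M : Finset (Fin N)} {i : Fin N} (hi : i ∉ M) (b : Fin N → Bool) :
    sgn M (flipBit i b) = sgn M b :=
  prod_congr rfl fun j hj => by rw [flipBit_of_ne (ne_of_mem_of_not_mem hj hi)]

lemma sgn_mul_self (M : Finset (Fin N)) (b : Fin N → Bool) : sgn M b * sgn M b = 1 := by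
  rw [sgn, ← prod_mul_distrib]
  exact prod_eq_one fun i _ => by split_ifs <;> norm_num

lemma sgn_eq_or (M : Finset (Fin N)) (b : Fin N → Bool) : sgn M b = 1 ∨ sgn M b = -1 :=
  mul_self_eq_one_iff.1 (sgn_mul_self M b)

lemma sgn_insert {M : Finset (Fin N)} {i : Fin N} (hi : i ∉ M) (b : Fin N → Bool) :
    sgn (insert i M) b = (if b i then -1 else 1) * sgn M b :=
  prod_insert hi

/-- Huang's signed adjacency operator of the cube in the directions `M`. -/
def signedAdj (M : Finset (Fin N)) :
    ((Fin N → Bool) → ℝ) →ₗ[ℝ] ((Fin N → Bool) → ℝ) where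
  toFun v b := ∑ i ∈ M, sgn (Iio i) b * v (flipBit i b)
  map_add' u v := by
    ext b
    simp [mul_add, sum_add_distrib]
  map_smul' c v := by
    ext b
    simp only [Pi.smul_apply, smul_eq_mul, RingHom.id_apply, mul_sum]
    exact sum_congr rfl fun i _ => by ring

lemma signedAdj_apply (M : Finset (Fin N)) (v : (Fin N → Bool) → ℝ) (b : Fin N → Bool) :
    signedAdj M v b = ∑ i ∈ M, sgn (Iio i) b * v (flipBit i b) := rfl

/-- The signs make flips in distinct directions anticommute, while each signed flip squares to the
identity. Hence the only possible eigenvalues are `±√#M`. -/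
lemma signedAdj_signedAdj (M : Finset (Fin N)) (v : (Fin N → Bool) → ℝ) :
    signedAdj M (signedAdj M v) = (#M : ℝ) • v := by
  ext b
  simp only [signedAdj_apply, mul_sum, Pi.smul_apply, smul_eq_mul]
  set T : Fin N → Fin N → ℝ := fun i j =>
    sgn (Iio i) b * (sgn (Iio j) (flipBit i b) * v (flipBit j (flipBit i b))) with hT
  have hd : ∀ i, T i i = v b := fun i => by
    simp only [hT, flipBit_flipBit]
    rw [sgn_flipBit_of_notMem (by simp), ← mul_assoc, sgn_mul_self, one_mul]
  have hlt : ∀ i j, i < j → T i j = -T j i := fun i j h => by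
    simp only [hT]
    rw [sgn_flipBit_of_mem (by simpa using h), sgn_flipBit_of_notMem (by simpa using h.le),
      flipBit_comm]
    ring
  have hne : ∀ i j, i ≠ j → T i j = -T j i := fun i j h => by
    rcases lt_or_gt_of_ne h with h | h
    · exact hlt i j h
    · rw [hlt j i h, neg_neg]
  have hsym : ∀ i j, T i j + T j i = if i = j then 2 * v b else 0 := fun i j => by
    split_ifs with h
    · subst h; rw [hd]; ring
    · rw [hne i j h]; ring
  have h2 : 2 * ∑ i ∈ M, ∑ j ∈ M, T i j = 2 * (#M * v b) := by
    rw [two_mul]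
    nth_rewrite 2 [sum_comm]
    rw [← sum_add_distrib]
    simp only [← sum_add_distrib, hsym]
    simp
    ring
  linarith

/-- Multiplication with the parity of all bits in `M`. -/
def parityMul (M : Finset (Fin N)) : ((Fin N → Bool) → ℝ) →ₗ[ℝ] ((Fin N → Bool) → ℝ) where
  toFun v b := sgn M b * v b
  map_add' u v := by ext b; simp [mul_add]
  map_smul' c v := by ext b; simp [mul_left_comm]

lemma parityMul_apply (M : Finset (Fin N)) (v : (Fin N → Bool) → ℝ) (b : Fin N → Bool) :
    parityMul M v b = sgn M b * v b := rfl

lemma parityMul_injective (M : Finset (Fin N)) : Function.Injective (parityMul M) := by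
  intro u v h
  ext b
  have := congrFun h b
  simp only [parityMul_apply] at this
  rcases sgn_eq_or M b with h | h <;> rw [h] at this <;> linarith

/-- Every flip in a direction of `M` reverses the parity. Multiplication with it therefore exchanges
the two eigenspaces, so that the negative one has at most half of the full dimension. -/
lemma signedAdj_parityMul (M : Finset (Fin N)) (v : (Fin N → Bool) → ℝ) :
    signedAdj M (parityMul M v) = -parityMul M (signedAdj M v) := by
  ext b
  simp only [signedAdj_apply, parityMul_apply, Pi.neg_apply, mul_sum, ← sum_neg_distrib]
  refine sum_congr rfl fun i hi => ?_
  rw [sgn_flipBit_of_mem hi]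
  ring

/-- More than half of the vertices of the cube support an eigenvector of the signed adjacency
operator with eigenvalue `√#M`. -/
lemma exists_signedAdj_eigenvector {M : Finset (Fin N)} (hM : M.Nonempty)
    (H : Finset (Fin N → Bool)) (hH : 2 ^ N < 2 * #H) :
    ∃ v : (Fin N → Bool) → ℝ, v ≠ 0 ∧ (∀ b ∉ H, v b = 0) ∧
      signedAdj M v = √(#M : ℝ) • v := by
  set r : ℝ := √(#M : ℝ) with hr
  have hrr : r * r = #M := Real.mul_self_sqrt (by positivity)
  have hr0 : 0 < r := Real.sqrt_pos.2 (by exact_mod_cast hM.card_pos)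
  set L : ((Fin N → Bool) → ℝ) →ₗ[ℝ] ((Fin N → Bool) → ℝ) := signedAdj M - r • LinearMap.id
  set Em := LinearMap.ker (signedAdj M + r • LinearMap.id) with hEm
  set Ep := LinearMap.ker L with hEp
  have memEm : ∀ v, v ∈ Em ↔ signedAdj M v = -(r • v) := fun v => by
    simp [hEm, add_eq_zero_iff_eq_neg]
  have memEp : ∀ v, v ∈ Ep ↔ signedAdj M v = r • v := fun v => by
    simp [hEp, L, sub_eq_zero]
  -- `(A + r)(A - r) = A² - r² = 0` for the signed adjacency operator `A`.
  have hrange : ∀ v, L v ∈ Em := fun v => by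
    rw [memEm]
    simp only [L, LinearMap.sub_apply, LinearMap.smul_apply, LinearMap.id_apply, map_sub,
      map_smul, signedAdj_signedAdj, ← hrr, smul_sub, smul_smul]
    abel
  have hdisj : Disjoint Em Ep := by
    rw [Submodule.disjoint_def]
    intro v h1 h2
    rw [memEm] at h1
    rw [memEp, h1] at h2
    have : (r + r) • v = 0 := by
      rw [add_smul]
      nth_rewrite 1 [← h2]
      simp
    exact (smul_eq_zero.1 this).resolve_left (by positivity)
  have hle : Module.finrank ℝ Em ≤ Module.finrank ℝ Ep := by
    have hmap : Em.map (parityMul M) ≤ Ep := by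
      rintro _ ⟨v, hv, rfl⟩
      rw [memEp, signedAdj_parityMul, (memEm v).1 hv, map_neg, map_smul, neg_neg]
    calc Module.finrank ℝ Em = Module.finrank ℝ (Em.map (parityMul M)) :=
          (Submodule.equivMapOfInjective _ (parityMul_injective M) Em).finrank_eq
      _ ≤ _ := Submodule.finrank_mono hmap
  have hhalf : 2 * Module.finrank ℝ Em ≤ 2 ^ N := by
    have h1 := Submodule.finrank_add_finrank_le_of_disjoint hdisj
    have h2 : Module.finrank ℝ ((Fin N → Bool) → ℝ) = 2 ^ N := by simp
    rw [h2] at h1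
    omega
  set ext0 : (H → ℝ) →ₗ[ℝ] ((Fin N → Bool) → ℝ) := Function.ExtendByZero.linearMap ℝ Subtype.val
  have hext : ∀ (a : H → ℝ) (b) (hb : b ∈ H), ext0 a b = a ⟨b, hb⟩ := fun a b hb =>
    Subtype.val_injective.extend_apply a 0 ⟨b, hb⟩
  have hext0 : ∀ (a : H → ℝ) (b), b ∉ H → ext0 a b = 0 := fun a b hb =>
    Function.extend_apply' (f := Subtype.val) a 0 b fun ⟨c, hc⟩ => hb (hc ▸ c.2)
  set K : (H → ℝ) →ₗ[ℝ] Em := (L ∘ₗ ext0).codRestrict Em fun a => hrange _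
  -- The functions supported on `H` form a space of dimension `#H > 2^N / 2 ≥ dim Em`, so `L` kills
  -- a nonzero one.
  have hker : LinearMap.ker K ≠ ⊥ := LinearMap.ker_ne_bot_of_finrank_lt (by
    rw [Module.finrank_fintype_fun_eq_card, Fintype.card_coe]
    omega)
  obtain ⟨a, ha, ha0⟩ := (Submodule.ne_bot_iff _).1 hker
  refine ⟨ext0 a, ?_, fun b hb => hext0 a b hb, ?_⟩
  · intro h
    apply ha0
    ext b
    rw [← hext a b b.2, h]
    rfl
  · rw [← memEp, hEp, LinearMap.mem_ker]
    exact congrArg Subtype.val (LinearMap.mem_ker.1 ha)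

/-- A spectral form of Huang's theorem: the subgraph of the cube with edge directions `M` that is
induced by more than half of the vertices has spectral norm at least `√#M`. -/
theorem exists_weight_of_card_gt_half {M : Finset (Fin N)} (hM : M.Nonempty)
    (H : Finset (Fin N → Bool)) (hH : 2 ^ N < 2 * #H) :
    ∃ v : (Fin N → Bool) → ℝ, (∀ b, 0 ≤ v b) ∧ (∀ b ∉ H, v b = 0) ∧ 0 < ∑ b, v b ^ 2 ∧
      √(#M : ℝ) * ∑ b, v b ^ 2 ≤ ∑ b, ∑ i ∈ M, v b * v (flipBit i b) := by
  obtain ⟨u, hu0, hus, hu⟩ := exists_signedAdj_eigenvector hM H hH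
  -- Absolute values remove the signs: by the triangle inequality the quadratic form of the unsigned
  -- adjacency operator can only grow.
  refine ⟨fun b => |u b|, fun b => abs_nonneg _, fun b hb => by simp [hus b hb], ?_, ?_⟩
  · obtain ⟨b, hb⟩ := Function.ne_iff.1 hu0
    refine sum_pos' (fun b _ => by positivity) ⟨b, mem_univ b, ?_⟩
    have : u b ≠ 0 := hb
    positivity
  · rw [mul_sum]
    refine sum_le_sum fun b _ => ?_
    have h1 : √(#M : ℝ) * |u b| ^ 2 = u b * signedAdj M u b := by
      rw [hu, sq_abs]
      simp
      ring
    rw [h1, signedAdj_apply, mul_sum]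
    refine sum_le_sum fun i _ => ?_
    refine (le_abs_self _).trans (le_of_eq ?_)
    rw [abs_mul, abs_mul]
    rcases sgn_eq_or (Iio i) b with h | h <;> simp [h]

end

/-! ### Block flips and connectivity of subcubes -/

section

variable {N : ℕ} {Y : Type u}

/-- Flip all bits in the block `B`. -/
def flipBlock (B : Finset (Fin N)) (X : Fin N → Bool) : Fin N → Bool :=
  fun j => xor (X j) (decide (j ∈ B))

@[simp] lemma flipBlock_empty (X : Fin N → Bool) : flipBlock ∅ X = X := by
  ext j; simp [flipBlock]

lemma flipBlock_insert {i : Fin N} {B : Finset (Fin N)} (hi : i ∉ B) (X : Fin N → Bool) :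
    flipBlock (insert i B) X = flipBit i (flipBlock B X) := by
  ext j
  by_cases h : j = i
  · subst h; simp [flipBlock, flipBit, hi]
  · simp [flipBlock, flipBit, h]

lemma flipBlock_ne (X X' : Fin N → Bool) :
    flipBlock ({i | X i ≠ X' i} : Finset (Fin N)) X = X' := by
  ext j
  by_cases h : X j = X' j
  · simp [flipBlock, h]
  · simp only [flipBlock, mem_filter, mem_univ, true_and, ne_eq, h, not_false_eq_true,
      decide_true]
    revert h
    cases X j <;> cases X' j <;> simp

/-- Any two inputs that agree on `S` are connected by flips of single bits outside of `S`. -/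
lemma cube_induction {S : Finset (Fin N)} {p : (Fin N → Bool) → Prop} {X X' : Fin N → Bool}
    (hX : p X) (hstep : ∀ i ∉ S, ∀ Z, (∀ j ∈ S, Z j = X j) → p Z → p (flipBit i Z))
    (h : ∀ j ∈ S, X' j = X j) : p X' := by
  have key : ∀ T : Finset (Fin N), Disjoint T S →
      (∀ j ∈ S, flipBlock T X j = X j) ∧ p (flipBlock T X) := by
    intro T
    induction T using Finset.induction_on with
    | empty => simpa using hX
    | insert i T hi ih =>
      intro hd
      rw [disjoint_insert_left] at hd
      obtain ⟨h1, h2⟩ := ih hd.2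
      rw [flipBlock_insert hi]
      refine ⟨fun j hj => ?_, hstep i hd.1 _ h1 h2⟩
      rw [flipBit_of_ne (ne_of_mem_of_not_mem hj hd.1), h1 j hj]
  have := (key {i | X i ≠ X' i} (by
    rw [disjoint_left]
    intro j hj hjS
    simp only [mem_filter, mem_univ, true_and] at hj
    exact hj (h j hjS).symm)).2
  rwa [flipBlock_ne] at this

/-! ### Block sensitivity -/

/-- Weight 1 is put on each pair of `X` and a sensitive flip of it. Disjoint blocks share the total
query weight 1 of `X`, so Cauchy–Schwarz bounds the adversary sum by `√#ℬ`. Thus `#ℬ ≤ 72 * q *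
√#ℬ`, and `5184 = 72²`. -/
theorem QuantumAlgorithm.card_sensitive_blocks_le (A : QuantumAlgorithm N Y)
    {f : (Fin N → Bool) → Y} (hf : ∀ X, 2 / 3 ≤ A.prob X (f X)) (X : Fin N → Bool)
    (ℬ : Finset (Finset (Fin N))) (hdisj : (ℬ : Set (Finset (Fin N))).PairwiseDisjoint id)
    (hsens : ∀ B ∈ ℬ, f (flipBlock B X) ≠ f X) : #ℬ ≤ 5184 * A.queries ^ 2 := by
  have hD : ∀ B : Finset (Fin N), ({i | X i ≠ flipBlock B X i} : Finset (Fin N)) = B := by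
    intro B
    ext i
    rw [mem_filter_univ, flipBlock]
    by_cases h : i ∈ B <;> cases X i <;> simp [h]
  have h := A.sum_weight_le hf (P := ℬ) (fun _ => X) (fun B => flipBlock B X) (fun _ => 1)
    (fun _ => zero_le_one) (fun B _ => (hsens B B.2).symm) (B := √(#ℬ : ℝ)) (by
      intro μ h0 h1
      simp only [hD, one_mul]
      calc ∑ B : ℬ, √(∑ i ∈ B.1, μ X i) * √(∑ i ∈ B.1, μ (flipBlock B.1 X) i)
          ≤ ∑ B : ℬ, √(∑ i ∈ B.1, μ X i) * √(1 : ℝ) := by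
            refine sum_le_sum fun B _ => mul_le_mul_of_nonneg_left ?_ (Real.sqrt_nonneg _)
            refine Real.sqrt_le_sqrt ?_
            rw [← h1 (flipBlock B.1 X)]
            exact sum_le_sum_of_subset_of_nonneg (subset_univ _) fun i _ _ => h0 _ i
        _ ≤ √(∑ B : ℬ, ∑ i ∈ B.1, μ X i) * √(∑ B : ℬ, (1 : ℝ)) :=
            Real.sum_sqrt_mul_sqrt_le _ (fun B => sum_nonneg fun i _ => h0 X i)
              (fun _ => zero_le_one)
        _ ≤ 1 * √(#ℬ : ℝ) := by
            have e : ∑ B : ℬ, (1 : ℝ) = #ℬ := by simp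
            rw [e]
            refine mul_le_mul_of_nonneg_right ?_ (Real.sqrt_nonneg _)
            rw [Real.sqrt_le_one, sum_coe_sort ℬ (fun B => ∑ i ∈ B, μ X i),
              ← h1 X]
            refine (sum_biUnion (t := id) (f := μ X) hdisj).symm.trans_le ?_
            exact sum_le_sum_of_subset_of_nonneg (subset_univ _) fun i _ _ => h0 _ i
        _ = √(#ℬ : ℝ) := one_mul _)
  have e : ∑ B : ℬ, (1 : ℝ) = #ℬ := by simp
  rw [e] at h
  set s := √(#ℬ : ℝ) with hs
  have hss : s * s = #ℬ := Real.mul_self_sqrt (by positivity)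
  have hs0 : 0 ≤ s := Real.sqrt_nonneg _
  have hle : s ≤ 72 * A.queries := by
    rcases hs0.eq_or_lt with h' | h'
    · rw [← h']; positivity
    · rw [← hss] at h
      exact le_of_mul_le_mul_right h h'
  have : (#ℬ : ℝ) ≤ 5184 * (A.queries : ℝ) ^ 2 := by
    rw [← hss]
    nlinarith [mul_self_le_mul_self hs0 hle]
  exact_mod_cast this

/-! ### Degree -/

/-- Flip those bits `j ∈ M` of `X` for which `b j` is true. -/
def xorOn (M : Finset (Fin N)) (X b : Fin N → Bool) : Fin N → Bool :=
  fun j => xor (X j) (b j && decide (j ∈ M))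

lemma xorOn_eq_flipBlock (M : Finset (Fin N)) (X b : Fin N → Bool) :
    xorOn M X b = flipBlock (M.filter fun j => b j) X := by
  ext j
  by_cases h : j ∈ M <;> simp [xorOn, flipBlock, h]

lemma xorOn_flipBit_of_mem {M : Finset (Fin N)} {i : Fin N} (hi : i ∈ M) (X b : Fin N → Bool) :
    xorOn M X (flipBit i b) = flipBit i (xorOn M X b) := by
  ext j
  by_cases h : j = i
  · subst h; cases X j <;> cases b j <;> simp [xorOn, flipBit, hi]
  · simp [xorOn, flipBit, h]

lemma xorOn_flipBit_left (M : Finset (Fin N)) (i : Fin N) (X b : Fin N → Bool) :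
    xorOn M (flipBit i X) b = flipBit i (xorOn M X b) := by
  ext j
  exact Bool.xor_right_comm ..

lemma xorOn_insert {M : Finset (Fin N)} {i : Fin N} (hi : i ∉ M) (X b : Fin N → Bool) :
    xorOn (insert i M) X b = if b i then flipBit i (xorOn M X b) else xorOn M X b := by
  ext j
  by_cases h : j = i
  · subst h
    cases hb : b j <;> simp [xorOn, flipBit, hi, hb]
  · cases hb : b i <;> simp [xorOn, flipBit, h]

open Classical in
/-- The `±1`-valued indicator function of `f X = y`. -/
def signIndicator (f : (Fin N → Bool) → Y) (y : Y) (X : Fin N → Bool) : ℝ :=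
  if f X = y then 1 else -1

lemma signIndicator_eq_or (f : (Fin N → Bool) → Y) (y : Y) (X : Fin N → Bool) :
    signIndicator f y X = 1 ∨ signIndicator f y X = -1 := by
  unfold signIndicator; split_ifs <;> simp

/-- The alternating sum of a function over the subcube through `X` with directions `M`
(times `2 ^ (N - #M)`). It vanishes iff the monomial of `M` is missing in the restriction to that
subcube. -/
def altSum (F : (Fin N → Bool) → ℝ) (M : Finset (Fin N)) (X : Fin N → Bool) : ℝ :=
  ∑ b, sgn M b * F (xorOn M X b)

lemma altSum_empty (F : (Fin N → Bool) → ℝ) (X : Fin N → Bool) :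
    altSum F ∅ X = 2 ^ N * F X := by
  have h : ∀ b, xorOn ∅ X b = X := fun b => by ext j; simp [xorOn]
  simp [altSum, sgn, h]

lemma altSum_flipBit_of_mem (F : (Fin N → Bool) → ℝ) {M : Finset (Fin N)} {i : Fin N}
    (hi : i ∈ M) (X : Fin N → Bool) : altSum F M (flipBit i X) = -altSum F M X := by
  rw [altSum, altSum, ← sum_flipBit i, ← sum_neg_distrib]
  refine sum_congr rfl fun b _ => ?_
  rw [sgn_flipBit_of_mem hi, xorOn_flipBit_left, xorOn_flipBit_of_mem hi, flipBit_flipBit]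
  ring

/-- A new direction acts as a discrete derivative. The factor 2 appears because `altSum F M` also
sums over the coordinate `b i`, on which its summands do not depend. If the left side vanishes,
flipping `i` leaves `altSum F M` unchanged. -/
lemma two_mul_altSum_insert (F : (Fin N → Bool) → ℝ) {M : Finset (Fin N)} {i : Fin N}
    (hi : i ∉ M) (X : Fin N → Bool) :
    2 * altSum F (insert i M) X = altSum F M X - altSum F M (flipBit i X) := by
  have h : 2 * altSum F (insert i M) X = altSum F (insert i M) X +
      ∑ b, sgn (insert i M) (flipBit i b) * F (xorOn (insert i M) X (flipBit i b)) := by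
    rw [sum_flipBit i fun b => sgn (insert i M) b * F (xorOn (insert i M) X b), two_mul]
    rfl
  rw [h]
  simp only [altSum]
  rw [← sum_add_distrib, ← sum_sub_distrib]
  refine sum_congr rfl fun b _ => ?_
  rw [sgn_flipBit_of_mem (mem_insert_self i M), xorOn_flipBit_of_mem (mem_insert_self i M),
    sgn_insert hi, xorOn_insert hi, xorOn_flipBit_left]
  cases b i <;> simp <;> ring

lemma sum_sgn_eq_zero {M : Finset (Fin N)} (hM : M.Nonempty) : ∑ b, sgn M b = 0 := by
  obtain ⟨i, hi⟩ := hM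
  have h := sum_flipBit i (sgn M)
  simp only [sgn_flipBit_of_mem hi, sum_neg_distrib] at h
  linarith

lemma exists_two_mul_card_gt {α : Type*} [Fintype α] {τ : α → ℝ} (hτ : ∀ b, τ b = 1 ∨ τ b = -1)
    (h : ∑ b, τ b ≠ 0) : ∃ e : ℝ, Fintype.card α < 2 * #{b | τ b = e} := by
  have h1 : #{b | τ b = 1} + #{b | ¬ τ b = 1} = Fintype.card α :=
    card_filter_add_card_filter_not (s := univ) fun b => τ b = 1
  have h2 : ({b | ¬ τ b = 1} : Finset α) = ({b | τ b = -1} : Finset α) := by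
    refine filter_congr fun b _ => ?_
    rcases hτ b with h | h <;> rw [h] <;> norm_num
  have h3 : ∑ b, τ b = #{b | τ b = 1} - #{b | ¬ τ b = 1} := by
    rw [← sum_filter_add_sum_filter_not univ (fun b => τ b = 1), sub_eq_add_neg]
    congr 1
    · rw [sum_congr rfl fun b hb => (mem_filter.1 hb).2]; simp
    · rw [h2, sum_congr rfl fun b hb => (mem_filter.1 hb).2]; simp
  rcases lt_trichotomy #{b | τ b = 1} #{b | ¬ τ b = 1} with h' | h' | h'
  · exact ⟨-1, by rw [← h2]; omega⟩
  · exact absurd (by rw [h3, h', sub_self]) h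
  · exact ⟨1, by omega⟩

/-- The degree of the indicator functions of the outputs is `O(q²)`, on every subcube. -/
theorem QuantumAlgorithm.card_le_of_altSum_ne_zero (A : QuantumAlgorithm N Y)
    {f : (Fin N → Bool) → Y} (hf : ∀ X, 2 / 3 ≤ A.prob X (f X)) {y : Y} {M : Finset (Fin N)}
    (hM : M.Nonempty) {X : Fin N → Bool} (hc : altSum (signIndicator f y) M X ≠ 0) :
    #M ≤ 5184 * A.queries ^ 2 := by
  have hτ : ∀ b, sgn M b * signIndicator f y (xorOn M X b) = 1 ∨
      sgn M b * signIndicator f y (xorOn M X b) = -1 := fun b => by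
    rcases sgn_eq_or M b with h | h <;>
      rcases signIndicator_eq_or f y (xorOn M X b) with h' | h' <;> rw [h, h'] <;> norm_num
  -- Along an edge in a direction of `M` the parity changes. If both ends lie in the majority set of
  -- `e`, the indicator must change too, and so must `f`.
  obtain ⟨e, he⟩ := exists_two_mul_card_gt hτ hc
  rw [Fintype.card_fun, Fintype.card_bool, Fintype.card_fin] at he
  obtain ⟨v, hv0, hvs, hvpos, hv⟩ := exists_weight_of_card_gt_half hM _ he
  -- The total weight is at least `√#M * ∑ b, v b ^ 2`. Since each pair differs in a single index,
  -- AM-GM splits the adversary sum into two halves, each charging `v b ^ 2` against query weights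
  -- that sum to at most 1.
  have h := A.sum_weight_le hf (P := (Fin N → Bool) × M) (fun p => xorOn M X p.1)
    (fun p => xorOn M X (flipBit p.2 p.1)) (fun p => v p.1 * v (flipBit p.2 p.1))
    (fun p => mul_nonneg (hv0 _) (hv0 _)) ?_ (B := ∑ b, v b ^ 2) ?_
  · rw [Fintype.sum_prod_type] at h
    have hsum : ∀ b, ∑ i : M, v b * v (flipBit i.1 b) = ∑ i ∈ M, v b * v (flipBit i b) :=
      fun b => sum_coe_sort M fun i => v b * v (flipBit i b)
    simp only [hsum] at h
    have hle : √(#M : ℝ) ≤ 72 * A.queries := le_of_mul_le_mul_right (hv.trans h) hvpos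
    have : (#M : ℝ) ≤ 5184 * (A.queries : ℝ) ^ 2 := by
      rw [← Real.mul_self_sqrt (Nat.cast_nonneg #M)]
      nlinarith [mul_self_le_mul_self (Real.sqrt_nonneg (#M : ℝ)) hle]
    exact_mod_cast this
  · rintro ⟨b, i, hi⟩ hw hff
    have h1 : v b ≠ 0 := left_ne_zero_of_mul hw
    have h2 : v (flipBit i b) ≠ 0 := right_ne_zero_of_mul hw
    have h1' := not_imp_comm.1 (hvs b) h1
    have h2' := not_imp_comm.1 (hvs _) h2
    simp only [mem_filter, mem_univ, true_and] at h1' h2'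
    have hs : signIndicator f y (xorOn M X (flipBit i b)) = signIndicator f y (xorOn M X b) := by
      simp only [signIndicator]
      rw [show f (xorOn M X (flipBit i b)) = f (xorOn M X b) from hff.symm]
    rw [sgn_flipBit_of_mem hi, hs, neg_mul, h1'] at h2'
    rcases hτ b with h | h <;> rw [h1'] at h <;> linarith
  · intro μ h0 h1
    have hD : ∀ p : (Fin N → Bool) × M,
        ({j | xorOn M X p.1 j ≠ xorOn M X (flipBit p.2 p.1) j} : Finset (Fin N)) = {p.2.1} := by
      rintro ⟨b, i, hi⟩
      ext j
      simp only [mem_filter, mem_univ, true_and, mem_singleton, xorOn_flipBit_of_mem hi]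
      by_cases h : j = i
      · simp [h]
      · simp [flipBit_of_ne h, h]
    simp only [hD, sum_singleton]
    have hsplit : ∑ p : (Fin N → Bool) × M, v p.1 ^ 2 * μ (xorOn M X p.1) p.2 ≤ ∑ b, v b ^ 2 := by
      rw [Fintype.sum_prod_type]
      refine sum_le_sum fun b _ => ?_
      simp only
      rw [← mul_sum, sum_coe_sort M (fun i => μ (xorOn M X b) i)]
      refine mul_le_of_le_one_right (by positivity) ?_
      rw [← h1 (xorOn M X b)]
      exact sum_le_sum_of_subset_of_nonneg (subset_univ _) fun i _ _ => h0 _ i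
    have hsplit' : ∑ p : (Fin N → Bool) × M,
        v (flipBit p.2 p.1) ^ 2 * μ (xorOn M X (flipBit p.2 p.1)) p.2 ≤ ∑ b, v b ^ 2 := by
      refine le_trans (le_of_eq ?_) hsplit
      rw [Fintype.sum_prod_type, Fintype.sum_prod_type, sum_comm]
      nth_rewrite 2 [sum_comm]
      exact sum_congr rfl fun i _ =>
        sum_flipBit i.1 fun b => v b ^ 2 * μ (xorOn M X b) i
    have hterm : ∀ p : (Fin N → Bool) × M, v p.1 * v (flipBit p.2 p.1) *
        (√(μ (xorOn M X p.1) p.2) * √(μ (xorOn M X (flipBit p.2 p.1)) p.2)) ≤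
        (v p.1 ^ 2 * μ (xorOn M X p.1) p.2 +
          v (flipBit p.2 p.1) ^ 2 * μ (xorOn M X (flipBit p.2 p.1)) p.2) / 2 := fun p => by
      have e1 := Real.sq_sqrt (h0 (xorOn M X p.1) p.2)
      have e2 := Real.sq_sqrt (h0 (xorOn M X (flipBit p.2 p.1)) p.2)
      nlinarith [sq_nonneg (v p.1 * √(μ (xorOn M X p.1) p.2) -
        v (flipBit p.2 p.1) * √(μ (xorOn M X (flipBit p.2 p.1)) p.2))]
    refine (sum_le_sum fun p _ => hterm p).trans ?_
    rw [← sum_div, sum_add_distrib]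
    linarith

/-- If `f` is not constant on a subcube, then there are few bits such that `f` stays nonconstant
on the subcube, no matter how the other bits are fixed. -/
theorem QuantumAlgorithm.exists_hitting_set (A : QuantumAlgorithm N Y)
    {f : (Fin N → Bool) → Y} (hf : ∀ X, 2 / 3 ≤ A.prob X (f X)) {S : Finset (Fin N)}
    {a X₁ : Fin N → Bool} (h1 : ∀ j ∈ S, X₁ j = a j) (hne : f X₁ ≠ f a) :
    ∃ M : Finset (Fin N), Disjoint M S ∧ #M ≤ 5184 * A.queries ^ 2 ∧
      ∀ X, (∀ j ∈ S, X j = a j) → ∃ B ⊆ M, f (flipBlock B X) ≠ f X := by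
  classical
  set F := signIndicator f (f a) with hF
  set 𝓕 : Finset (Finset (Fin N)) :=
    {M | M.Nonempty ∧ Disjoint M S ∧ ∃ X, (∀ j ∈ S, X j = a j) ∧ altSum F M X ≠ 0} with h𝓕
  have hedge : ∃ i ∉ S, ∃ X, (∀ j ∈ S, X j = a j) ∧ F X ≠ F (flipBit i X) := by
    by_contra! hcon
    have : F X₁ = F a := cube_induction (p := fun X => F X = F a) rfl
      (fun i hi Z hZ hp => (hcon i hi Z hZ).symm.trans hp) h1
    simp only [hF, signIndicator, if_neg hne] at this
    norm_num at this
  have h𝓕ne : 𝓕.Nonempty := by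
    obtain ⟨i, hi, X, hX, hXi⟩ := hedge
    refine ⟨{i}, ?_⟩
    simp only [h𝓕, mem_filter, mem_univ, true_and]
    refine ⟨singleton_nonempty i, by simpa using hi, X, hX, fun h0 => hXi ?_⟩
    have h2 := two_mul_altSum_insert F (notMem_empty i) X
    rw [insert_empty, h0, altSum_empty, altSum_empty, ← mul_sub, mul_zero] at h2
    exact sub_eq_zero.1 ((mul_eq_zero.1 h2.symm).resolve_left (by positivity))
  -- Maximality makes `altSum F (insert i M)` vanish for each `i` outside `M ∪ S`, so the
  -- alternating sum over `M` is nonzero throughout the subcube.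
  obtain ⟨M, hM𝓕, hmax⟩ := exists_max_image 𝓕 card h𝓕ne
  obtain ⟨hM, hMS, X₀, hX₀, hcX₀⟩ : M.Nonempty ∧ Disjoint M S ∧
      ∃ X, (∀ j ∈ S, X j = a j) ∧ altSum F M X ≠ 0 := by
    simpa only [h𝓕, mem_filter, mem_univ, true_and] using hM𝓕
  refine ⟨M, hMS, A.card_le_of_altSum_ne_zero hf hM hcX₀, fun X hX => ?_⟩
  have hcX : altSum F M X ≠ 0 := by
    refine cube_induction (S := S) (p := fun Z => altSum F M Z ≠ 0) hcX₀ (fun i hi Z hZ hp => ?_)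
      (fun j hj => (hX j hj).trans (hX₀ j hj).symm)
    by_cases hiM : i ∈ M
    · rwa [altSum_flipBit_of_mem F hiM, neg_ne_zero]
    · have h0 : altSum F (insert i M) Z = 0 := by
        by_contra hcon
        have := hmax (insert i M) (by
          simp only [h𝓕, mem_filter, mem_univ, true_and]
          exact ⟨insert_nonempty i M, disjoint_insert_left.2 ⟨hi, hMS⟩, Z,
            fun j hj => (hZ j hj).trans (hX₀ j hj), hcon⟩)
        rw [card_insert_of_notMem hiM] at this
        omega
      have h2 := two_mul_altSum_insert F hiM Z
      rw [h0, mul_zero] at h2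
      rwa [← sub_eq_zero.1 h2.symm]
  -- Otherwise `F` is constant on the subcube through `X` with directions `M`, and its alternating
  -- sum vanishes.
  by_contra! hcon
  apply hcX
  have : ∀ b, sgn M b * F (xorOn M X b) = sgn M b * F X := fun b => by
    rw [xorOn_eq_flipBlock, hF, signIndicator, signIndicator, hcon _ (filter_subset _ _)]
  rw [altSum, sum_congr rfl fun b _ => this b, ← sum_mul, sum_sgn_eq_zero hM, zero_mul]

/-! ### Decision trees -/

/-- Query all bits in `M` and go on with a tree that depends on the answers. -/
lemma exists_tree_of_query {f : (Fin N → Bool) → Y} {r : ℕ} (M : Finset (Fin N)) :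
    ∀ (S : Finset (Fin N)) (a : Fin N → Bool), Disjoint M S →
      (∀ a' : Fin N → Bool, (∀ j ∈ S, a' j = a j) → ∃ T : DecisionTree N Y, T.depth ≤ r ∧
        ∀ X : Fin N → Bool, (∀ j ∈ S ∪ M, X j = a' j) → T.output X = f X) →
      ∃ T : DecisionTree N Y, T.depth ≤ r + #M ∧
        ∀ X : Fin N → Bool, (∀ j ∈ S, X j = a j) → T.output X = f X := by
  induction M using Finset.induction_on with
  | empty =>
    intro S a _ h
    simpa using h a fun _ _ => rfl
  | insert i M hi ih =>
    intro S a hd h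
    rw [disjoint_insert_left] at hd
    have hT : ∀ c : Bool, ∃ T : DecisionTree N Y, T.depth ≤ r + #M ∧
        ∀ X : Fin N → Bool, (∀ j ∈ insert i S, X j = Function.update a i c j) →
          T.output X = f X := fun c => by
      refine ih (insert i S) (Function.update a i c) (disjoint_insert_right.2 ⟨hi, hd.2⟩)
        fun a' ha' => ?_
      rw [insert_union, ← union_insert]
      refine h a' fun j hj => ?_
      rw [ha' j (mem_insert_of_mem hj),
        Function.update_of_ne (ne_of_mem_of_not_mem hj hd.1)]
    choose T hT1 hT2 using hT
    refine ⟨.query i T, ?_, fun X hX => ?_⟩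
    · rw [DecisionTree.depth, card_insert_of_notMem hi, ← add_assoc]
      exact Nat.add_le_add_right (max_le (hT1 _) (hT1 _)) 1
    · rw [DecisionTree.output]
      refine hT2 _ X fun j hj => ?_
      by_cases hji : j = i
      · subst hji; simp
      · rw [Function.update_of_ne hji, hX j (mem_of_mem_insert_of_ne hj hji)]

/-- If every subcube on which `f` is nonconstant has a hitting set with at most `d` bits, then
`f` has a decision tree of depth at most `d` times its block sensitivity. -/
lemma exists_tree_of_hitting_sets {f : (Fin N → Bool) → Y} {d : ℕ}
    (hhit : ∀ (S : Finset (Fin N)) (a X₁ : Fin N → Bool), (∀ j ∈ S, X₁ j = a j) → f X₁ ≠ f a →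
      ∃ M : Finset (Fin N), Disjoint M S ∧ #M ≤ d ∧
        ∀ X, (∀ j ∈ S, X j = a j) → ∃ B ⊆ M, f (flipBlock B X) ≠ f X) (k : ℕ) :
    ∀ (S : Finset (Fin N)) (a : Fin N → Bool),
      (∀ X : Fin N → Bool, (∀ j ∈ S, X j = a j) → ∀ ℬ : Finset (Finset (Fin N)),
        (ℬ : Set (Finset (Fin N))).PairwiseDisjoint id → (∀ B ∈ ℬ, Disjoint B S) →
        (∀ B ∈ ℬ, f (flipBlock B X) ≠ f X) → #ℬ ≤ k) →
      ∃ T : DecisionTree N Y, T.depth ≤ k * d ∧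
        ∀ X : Fin N → Bool, (∀ j ∈ S, X j = a j) → T.output X = f X := by
  induction k with
  | zero =>
    intro S a hbs
    -- With no sensitive blocks available `f` must be constant on the subcube, since a hitting set
    -- would supply one.
    refine ⟨.leaf (f a), by simp [DecisionTree.depth], fun X hX => ?_⟩
    by_contra hne
    obtain ⟨M, hMS, -, hM⟩ := hhit S a X hX (Ne.symm hne)
    obtain ⟨B, hB, hBs⟩ := hM X hX
    have := hbs X hX {B} (by simp) (by simpa using hMS.mono_left hB) (by simpa using hBs)
    simp at this
  | succ k ih =>
    intro S a hbs
    by_cases hconst : ∀ X : Fin N → Bool, (∀ j ∈ S, X j = a j) → f X = f a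
    · exact ⟨.leaf (f a), by simp [DecisionTree.depth], fun X hX => (hconst X hX).symm⟩
    push Not at hconst
    obtain ⟨X₁, hX₁, hne⟩ := hconst
    obtain ⟨M, hMS, hMd, hM⟩ := hhit S a X₁ hX₁ hne
    -- Once `M` is queried, the remaining blocks avoid it. A sensitive block inside `M` can be added
    -- to any disjoint family of them, so such a family has at most `k` members.
    obtain ⟨T, hT1, hT2⟩ := exists_tree_of_query (f := f) (r := k * d) M S a hMS
      fun a' ha' => ih (S ∪ M) a' fun X hX ℬ hdis hℬS hsens => by
        have hXS : ∀ j ∈ S, X j = a j := fun j hj =>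
          (hX j (mem_union_left _ hj)).trans (ha' j hj)
        obtain ⟨B, hB, hBs⟩ := hM X hXS
        have hBdis : ∀ B' ∈ ℬ, Disjoint B B' := fun B' hB' =>
          ((disjoint_union_right.1 (hℬS B' hB')).2.mono_right hB).symm
        have hBnot : B ∉ ℬ := fun hmem => by
          have h0 : B = ∅ := disjoint_self_iff_empty B |>.1 (hBdis B hmem)
          rw [h0, flipBlock_empty] at hBs
          exact hBs rfl
        have hle := hbs X hXS (insert B ℬ)
          (by
            rw [coe_insert]
            exact hdis.insert fun B' hB' _ => hBdis B' hB')
          (by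
            intro B' hB'
            rcases mem_insert.1 hB' with rfl | hB'
            · exact hMS.mono_left hB
            · exact (disjoint_union_right.1 (hℬS B' hB')).1)
          (by
            intro B' hB'
            rcases mem_insert.1 hB' with rfl | hB'
            · exact hBs
            · exact hsens B' hB')
        rw [card_insert_of_notMem hBnot] at hle
        omega
    exact ⟨T, by rw [Nat.succ_mul]; omega, hT2⟩

/-- Pseudo-deterministic quantum algorithms have at most a quartic advantage. -/
theorem D_le_of_pseudoDeterministicallySolves {R : SearchProblem N Y} {A : QuantumAlgorithm N Y}
    (hA : A.PseudoDeterministicallySolves R) :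
    D R ≤ ((5184 ^ 2 * A.queries ^ 4 : ℕ) : ℕ∞) := by
  obtain ⟨f, hf⟩ := hA
  obtain ⟨T, hT1, hT2⟩ := exists_tree_of_hitting_sets (f := f) (d := 5184 * A.queries ^ 2)
    (fun S a X₁ h1 hne => A.exists_hitting_set (fun X => (hf X).2) h1 hne)
    (5184 * A.queries ^ 2) ∅ (fun _ => false) fun X _ ℬ hdis _ hsens =>
      A.card_sensitive_blocks_le (fun X => (hf X).2) X ℬ hdis hsens
  have hsol : T.Solves R := fun X => by
    rw [hT2 X (by simp)]
    exact (hf X).1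
  refine (iInf₂_le T hsol).trans (Nat.cast_le.2 (hT1.trans (le_of_eq (by ring))))

lemma exists_queries_eq_psQ {R : SearchProblem N Y} (h : psQ R ≠ ⊤) :
    ∃ A : QuantumAlgorithm N Y, A.PseudoDeterministicallySolves R ∧ psQ R = A.queries := by
  have hne : Nonempty {A : QuantumAlgorithm N Y // A.PseudoDeterministicallySolves R} := by
    by_contra hcon
    rw [not_nonempty_iff, isEmpty_subtype] at hcon
    exact h (by simp [psQ, hcon])
  obtain ⟨A, hA⟩ := ciInf_mem
    fun A : {A : QuantumAlgorithm N Y // A.PseudoDeterministicallySolves R} =>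
      (A.1.queries : ℕ∞)
  exact ⟨A.1, A.2, by rw [psQ, iInf_subtype', ← hA]⟩

end

end QueryComplexity

end

theorem theorem3 :
    ∃ C : ℝ≥0, ∀ (N : ℕ), 2 ≤ N → ∀ (Y : Type u) (R : QueryComplexity.SearchProblem N Y),
      R.IsTotal →
        (QueryComplexity.D R : ℝ≥0∞) ≤
          (C : ℝ≥0∞) * (QueryComplexity.psQ R : ℝ≥0∞) ^ 5 *
            ENNReal.ofReal (Real.logb 2 (N : ℝ)) := by
  refine ⟨5184 ^ 2, fun N hN Y R _ => ?_⟩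
  have hlog : 1 ≤ ENNReal.ofReal (Real.logb 2 (N : ℝ)) := by
    rw [ENNReal.one_le_ofReal, Real.le_logb_iff_rpow_le one_lt_two (by positivity)]
    simpa using (Nat.cast_le (α := ℝ)).2 hN
  refine le_trans ?_ (le_mul_of_one_le_right zero_le hlog)
  by_cases htop : QueryComplexity.psQ R = ⊤
  · rw [htop, ENat.toENNReal_top, ENNReal.top_pow (by norm_num),
      ENNReal.mul_top (by simp)]
    exact le_top
  obtain ⟨A, hA, hq⟩ := QueryComplexity.exists_queries_eq_psQ htop
  -- The case `q = 0` is separate only because monotonicity in the exponent needs a positive base.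
  have h1 : 5184 ^ 2 * A.queries ^ 4 ≤ 5184 ^ 2 * A.queries ^ 5 := by
    refine Nat.mul_le_mul_left _ ?_
    rcases Nat.eq_zero_or_pos A.queries with h | h
    · simp [h]
    · exact Nat.pow_le_pow_right h (by norm_num)
  have h2 := (QueryComplexity.D_le_of_pseudoDeterministicallySolves hA).trans
    (Nat.cast_le (α := ℕ∞) |>.2 h1)
  rw [hq]
  refine (ENat.toENNReal_le.2 h2).trans (le_of_eq ?_)
  norm_num
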